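/- Let $\mathbb F_q$ be a finite field, let $C\subseteq\mathbb F_q^n$ be a linear code of dimension $k$ and minimum weight $d_{\min}$, and let $C^\perp$ be its dual with respect to the usual inner product $u\cdot v=\sum_i u_iv_i$. For a linear code $D$ of length $n$ let $\operatorname{Supp}(D)$ be the set of coordinates $i\in E=\{1,\dots,n\}$ with $u_i\ne0$ for some $u\in D$, and let $\operatorname{wt}(D)=|\operatorname{Supp}(D)|$. For a linear code $B$ of length $n$ and integers $r,i\ge 0$, let $A_i^{(r)}(B)$ be the number of $r$-dimensional subcodes of $B$ of weight $i$, let $\mathcal S_{r,i}(B)$ be the multiset of the supports $\operatorname{Supp}(D)$, where $D$ runs over the $r$-dimensional subcodes of $B$ of weight $i$, and let $d_r(B)$ be the minimum of $\operatorname{wt}(D)$ over all $r$-dimensional subcodes $D$ of $B$ (the $r$-th generalized Hamming weight), with $d_r(B)=\infty$ if $r>\dim B$. Put $d_r=d_r(C)$, $d_r^\perp=d_r(C^\perp)$, and $[r]_\ell=\prod_{i=0}^{\ell-1}(q^r-q^i)$. A $t$-design on $E$ is a multiset of subsets of $E$ (blocks; repetitions and the empty multiset are allowed), all of the same size, such that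 every $t$-subset of $E$ is contained in the same number of blocks, counted with multiplicity. Let $r,t\ge1$ be integers with $r\le k$ and $t\le d_{\min}$, and for $1\le\mu\le r$ define $$\mathcal L_{\mu,t}=\Big\{\,i\in\mathbb Z\ :\ d_\mu^\perp\le i\le n-t,\ \ \sum_{\ell=0}^{\mu}[\mu]_\ell\,A_i^{(\ell)}(C^\perp)\ne0\Big\}.$$ **Theorem.** Suppose that $|\mathcal L_{\mu,t}|\le d_\mu-t$ for all $\mu=1,\dots,r$. Then $\mathcal S_{r,i}(C)$ is a $t$-design for every integer $i\ge d_r$, and $\mathcal S_{r,j}(C^\perp)$ is a $t$-design for every integer $j$ with $d_r^\perp\le j\le n-t$. -/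

import Mathlib

namespace SubcodeDesign

noncomputable section

variable {F : Type*} [Field F] {n : ℕ}

/-- The dual code: all vectors whose usual inner product with every codeword of `C` vanishes. -/
def dualCode (C : Submodule F (Fin n → F)) : Submodule F (Fin n → F) where
  carrier := {u | ∀ v ∈ C, u ⬝ᵥ v = 0}
  zero_mem' := fun v _ => zero_dotProduct v
  add_mem' := fun {a b} ha hb v hv => by
    rw [add_dotProduct, ha v hv, hb v hv, add_zero]
  smul_mem' := fun c u hu v hv => by
    rw [smul_dotProduct, hu v hv, smul_zero]

open Classical in
/-- The support of a subcode: the coordinates in which some vector of `D` is nonzero. -/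
def Supp (D : Submodule F (Fin n → F)) : Finset (Fin n) :=
  Finset.univ.filter fun i => ∃ u ∈ D, u i ≠ 0

/-- The weight of a subcode. -/
def wt (D : Submodule F (Fin n → F)) : ℕ := (Supp D).card

open Classical in
/-- The minimum weight (minimum number of nonzero coordinates of a nonzero codeword); it is `⊤`
for the zero code. -/
def minWeight (C : Submodule F (Fin n → F)) : ℕ∞ :=
  ⨅ u ∈ {u : Fin n → F | u ∈ C ∧ u ≠ 0}, (hammingNorm u : ℕ∞)

/-- The `r`-th generalized Hamming weight: the least weight of an `r`-dimensional subcode; it is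
`⊤` if there is no such subcode, that is, if `r` exceeds the dimension of `C`. -/
def genHammingWeight (C : Submodule F (Fin n → F)) (r : ℕ) : ℕ∞ :=
  ⨅ D ∈ {D : Submodule F (Fin n → F) | D ≤ C ∧ Module.finrank F D = r}, (wt D : ℕ∞)

/-- The product `∏_{i < b} (q ^ a - q ^ i)`. -/
def qProd (q a b : ℕ) : ℤ := ∏ i ∈ Finset.range b, ((q : ℤ) ^ a - (q : ℤ) ^ i)

/-- A multiset `B` of `k`-subsets of `Fin n` (repeated blocks allowed) is a `t`-`(n, k, lam)`
design: every `t`-subset lies in exactly `lam` blocks, counted with multiplicity. -/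
def IsDesign (t k lam : ℕ) (B : Multiset (Finset (Fin n))) : Prop :=
  (∀ X ∈ B, X.card = k) ∧
    ∀ T : Finset (Fin n), T.card = t → (B.filter fun X => T ⊆ X).card = lam

/-- A multiset of subsets of `Fin n` is a `t`-design. -/
def IsTDesign (t : ℕ) (B : Multiset (Finset (Fin n))) : Prop :=
  ∃ k lam : ℕ, IsDesign t k lam B

variable [Fintype F]

/-- The set of all `r`-dimensional subcodes of `C`. -/
def subcodes (C : Submodule F (Fin n → F)) (r : ℕ) : Finset (Submodule F (Fin n → F)) :=
  (Set.toFinite {D : Submodule F (Fin n → F) | D ≤ C ∧ Module.finrank F D = r}).toFinset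

/-- The multiset of supports of the `r`-dimensional subcodes of `C`, each subcode contributing
one block. -/
def supports (C : Submodule F (Fin n → F)) (r : ℕ) : Multiset (Finset (Fin n)) :=
  (subcodes C r).val.map Supp

/-- The blocks of size `i` in the multiset of supports of `r`-dimensional subcodes of `C`. -/
def supportsOfSize (C : Submodule F (Fin n → F)) (r i : ℕ) : Multiset (Finset (Fin n)) :=
  (supports C r).filter fun X => X.card = i

/-- The `r`-th higher weight distribution: the number of `r`-dimensional subcodes of weight `i`. -/
def higherWeight (C : Submodule F (Fin n → F)) (r i : ℕ) : ℕ :=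
  ((subcodes C r).filter fun D => wt D = i).card

open Classical in
/-- The set of weights `i` with `d_r(C^⊥) ≤ i ≤ n - t` and
`∑_{l = 0}^{r} [r]_l * A_i^{(l)}(C^⊥) ≠ 0`. -/
def dualWeights (C : Submodule F (Fin n → F)) (r t : ℕ) : Finset ℕ :=
  (Finset.range (n + 1)).filter fun i =>
    genHammingWeight (dualCode C) r ≤ (i : ℕ∞) ∧ i + t ≤ n ∧
      ∑ l ∈ Finset.range (r + 1),
        qProd (Fintype.card F) r l * (higherWeight (dualCode C) l i : ℤ) ≠ 0

end

end SubcodeDesign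

/-!
The argument is that of Assmus and Mattson, carried out for `m`-tuples of codewords. For a set `T` of
`s ≤ t` coordinates with complement `R`, the counts of `m`-dimensional subcodes of `C` punctured to
`R` (`puncturedCount`) and of the dual code shortened to `R` (`insideCount`) are shown to depend only
on `s`.

Sorting the `m`-tuples of words by the subcode they span turns the dimension formula
`finrank_dualCode_inf_add` into a system of linear identities (`macWilliams`) between the two families
of counts, in which the dimension `l ≤ m` enters with the number `numSpanning F m l` of spanning
`m`-tuples. By induction on `m` the terms with `l < m` depend only on `s`. So the differences of the
counts for two sets `R` and `R'` of equal size satisfy the identities with the terms for `l = m` only.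
An `m`-dimensional subcode of `C` has at least `d_m - s` points of its support in `R`, hence the
identities of degree less than `d_m - s` involve the shortened dual code alone; its differences vanish
outside the dual weights for `s`, of which there are at most `d_m - s` because there are at most
`d_m - t` for `t` (`card_dualWeights_le`). By `eq_zero_of_sum_mul_choose_eq_zero` these differences
vanish, and then so do those of the punctured code (`count_eq_of_count_lt_eq`).

It remains to pass from these counts to designs. For the dual code, the number of supports of given
size that avoid `T` is known for all `|T| ≤ t`, and points are moved one at a time from the avoided set
to the contained set (`isUniform_of_avoid`). For `C`, the number of supports with `j` points outside
`T` is known, and the number of supports of size `j + |T|` that contain `T` is obtained by induction on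
the size (`isUniform_of_sdiff`).
-/

namespace SubcodeDesign

/-! ### Dimensions of shortened and punctured codes -/

section Duality

variable {F : Type*} [Field F] {n : ℕ}

/-- The vectors of `F ^ n` that vanish outside `Y`. -/
def vanishingOutside (F : Type*) [Field F] {n : ℕ} (Y : Finset (Fin n)) :
    Submodule F (Fin n → F) :=
  LinearMap.ker (LinearMap.funLeft F F (Subtype.val : {i // i ∉ Y} → Fin n))

lemma mem_vanishingOutside {Y : Finset (Fin n)} {u : Fin n → F} :
    u ∈ vanishingOutside F Y ↔ ∀ i ∉ Y, u i = 0 := by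
  simp [vanishingOutside, funext_iff, LinearMap.funLeft_apply]

lemma mem_Supp {D : Submodule F (Fin n → F)} {i : Fin n} :
    i ∈ Supp D ↔ ∃ u ∈ D, u i ≠ 0 := by
  simp [Supp]

lemma Supp_subset_iff {D : Submodule F (Fin n → F)} {Y : Finset (Fin n)} :
    Supp D ⊆ Y ↔ D ≤ vanishingOutside F Y := by
  constructor
  · intro h u hu
    refine mem_vanishingOutside.2 fun i hi => ?_
    by_contra hne
    exact hi (h (mem_Supp.2 ⟨u, hu, hne⟩))
  · intro h i hi
    obtain ⟨u, hu, hne⟩ := mem_Supp.1 hi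
    by_contra hY
    exact hne (mem_vanishingOutside.1 (h hu) i hY)

lemma finrank_vanishingOutside (Y : Finset (Fin n)) :
    Module.finrank F (vanishingOutside F Y) = Y.card := by
  have hsurj := LinearMap.funLeft_surjective_of_injective F F
    (Subtype.val : {i // i ∉ Y} → Fin n) Subtype.val_injective
  have h := LinearMap.finrank_range_add_finrank_ker
    (LinearMap.funLeft F F (Subtype.val : {i // i ∉ Y} → Fin n))
  rw [LinearMap.range_eq_top.2 hsurj, finrank_top, Module.finrank_fintype_fun_eq_card,
    Module.finrank_fintype_fun_eq_card, Fintype.card_subtype_compl, Fintype.card_coe,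
    Fintype.card_fin] at h
  have := Finset.card_le_univ Y
  rw [Fintype.card_fin] at this
  change n - Y.card + Module.finrank F (vanishingOutside F Y) = n at h
  omega

lemma mem_dualCode {C : Submodule F (Fin n → F)} {u : Fin n → F} :
    u ∈ dualCode C ↔ ∀ v ∈ C, u ⬝ᵥ v = 0 := Iff.rfl

lemma finrank_dualCode (C : Submodule F (Fin n → F)) :
    Module.finrank F C + Module.finrank F (dualCode C) = n := by
  have h : dualCode C = C.dualAnnihilator.comap (dotProductEquiv F (Fin n)).toLinearMap := by
    ext u
    simp [mem_dualCode, Submodule.mem_dualAnnihilator]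
  have h2 := Subspace.finrank_add_finrank_dualAnnihilator_eq C
  rw [Module.finrank_fintype_fun_eq_card, Fintype.card_fin] at h2
  rw [h]
  refine (congrArg _ ?_).trans h2
  rw [Submodule.comap_equiv_eq_map_symm]
  exact LinearEquiv.finrank_map_eq _ _

lemma dualCode_inf_vanishingOutside (C : Submodule F (Fin n → F)) (Y : Finset (Fin n)) :
    dualCode C ⊓ vanishingOutside F Y = dualCode (C ⊔ vanishingOutside F Yᶜ) := by
  ext u
  simp only [Submodule.mem_inf, mem_dualCode]
  constructor
  · rintro ⟨hC, hY⟩ v hv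
    obtain ⟨a, ha, b, hb, rfl⟩ := Submodule.mem_sup.1 hv
    rw [dotProduct_add, hC a ha, zero_add]
    refine Finset.sum_eq_zero fun i _ => ?_
    by_cases hi : i ∈ Y
    · rw [mem_vanishingOutside.1 hb i (by simpa using hi), mul_zero]
    · rw [mem_vanishingOutside.1 hY i hi, zero_mul]
  · intro h
    refine ⟨fun v hv => h v (Submodule.mem_sup_left hv), mem_vanishingOutside.2 fun i hi => ?_⟩
    have := h (Pi.single i 1) (Submodule.mem_sup_right (mem_vanishingOutside.2 fun j hj => ?_))
    · simpa using this
    · rw [Pi.single_eq_of_ne]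
      rintro rfl
      simp [hi] at hj

/-- Shortening the dual code to `Y` is dual to puncturing `C` to `Y`: the dimension formula behind
the MacWilliams identities. -/
lemma finrank_dualCode_inf_add (C : Submodule F (Fin n → F)) (Y : Finset (Fin n)) :
    Module.finrank F (dualCode C ⊓ vanishingOutside F Y : Submodule F (Fin n → F)) +
        Module.finrank F C =
      Y.card + Module.finrank F (C ⊓ vanishingOutside F Yᶜ : Submodule F (Fin n → F)) := by
  have h1 := finrank_dualCode (C ⊔ vanishingOutside F Yᶜ)
  have h2 := Submodule.finrank_sup_add_finrank_inf_eq C (vanishingOutside F Yᶜ)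
  rw [finrank_vanishingOutside, Finset.card_compl, Fintype.card_fin] at h2
  rw [dualCode_inf_vanishingOutside]
  have := Finset.card_le_univ Y
  rw [Fintype.card_fin] at this
  omega

end Duality

/-! ### Tuples of codewords sorted by their span -/

section Tuples

variable {F : Type*} [Field F] {n : ℕ}

/-- The number of `m`-tuples of vectors that span `F ^ l`. -/
noncomputable def numSpanning (F : Type*) [Field F] (m l : ℕ) : ℕ :=
  Nat.card {v : Fin m → Fin l → F // Submodule.span F (Set.range v) = ⊤}

lemma numSpanning_eq_zero {m l : ℕ} (h : m < l) : numSpanning F m l = 0 := by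
  have : IsEmpty {v : Fin m → Fin l → F // Submodule.span F (Set.range v) = ⊤} := by
    refine ⟨fun ⟨v, hv⟩ => ?_⟩
    have h1 := finrank_range_le_card (R := F) v
    rw [Set.finrank, hv, finrank_top, Module.finrank_fintype_fun_eq_card, Fintype.card_fin,
      Fintype.card_fin] at h1
    omega
  exact Nat.card_of_isEmpty

lemma numSpanning_self_pos [Finite F] (m : ℕ) : 0 < numSpanning F m m := by
  have : Nonempty {v : Fin m → Fin m → F // Submodule.span F (Set.range v) = ⊤} :=
    ⟨⟨Pi.basisFun F (Fin m), (Pi.basisFun F (Fin m)).span_eq⟩⟩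
  exact Nat.card_pos

/-- The number of `m`-tuples spanning a given subspace depends only on its dimension. -/
lemma card_span_eq {V : Type*} [AddCommGroup V] [Module F V] (m : ℕ) (D : Submodule F V)
    [FiniteDimensional F D] :
    Nat.card {v : Fin m → V // Submodule.span F (Set.range v) = D} =
      numSpanning F m (Module.finrank F D) := by
  let e : D ≃ₗ[F] (Fin (Module.finrank F D) → F) := (Module.finBasis F D).equivFun
  have key : ∀ v : Fin m → D, Submodule.span F (Set.range fun i => (v i : V)) = D ↔
      Submodule.span F (Set.range fun i => e (v i)) = ⊤ := by
    intro v
    have h1 : Submodule.span F (Set.range fun i => (v i : V)) =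
        (Submodule.span F (Set.range v)).map D.subtype := by
      rw [Submodule.map_span, ← Set.range_comp]; rfl
    have h2 : Submodule.span F (Set.range fun i => e (v i)) =
        (Submodule.span F (Set.range v)).map e.toLinearMap := by
      rw [Submodule.map_span, ← Set.range_comp]; rfl
    rw [h1, h2]
    constructor
    · intro h
      have : Submodule.span F (Set.range v) = ⊤ := by
        apply Submodule.map_injective_of_injective D.injective_subtype
        rw [h, Submodule.map_top, Submodule.range_subtype]
      rw [this, Submodule.map_top, LinearEquiv.range]
    · intro h
      have : Submodule.span F (Set.range v) = ⊤ := by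
        apply Submodule.map_injective_of_injective e.injective
        rw [h, Submodule.map_top, LinearEquiv.range]
      rw [this, Submodule.map_top, Submodule.range_subtype]
  refine Nat.card_congr ⟨fun v => ⟨fun i => e ⟨v.1 i, ?_⟩, ?_⟩,
    fun w => ⟨fun i => (e.symm (w.1 i) : V), ?_⟩, fun v => ?_, fun w => ?_⟩
  · exact v.2.le (Submodule.subset_span ⟨i, rfl⟩)
  · exact (key _).1 v.2
  · refine (key fun i => e.symm (w.1 i)).2 ?_
    simpa using w.2
  · simp
  · simp

variable [Fintype F]

lemma mem_subcodes {C D : Submodule F (Fin n → F)} {l : ℕ} :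
    D ∈ subcodes C l ↔ D ≤ C ∧ Module.finrank F D = l := by
  simp [subcodes]

open Classical in
/-- Sorting the `m`-tuples of words of `C` vanishing outside `Y` by the subcode they span. -/
lemma pow_finrank_inf_eq_sum (C : Submodule F (Fin n → F)) (Y : Finset (Fin n)) (m : ℕ) :
    (Fintype.card F ^ Module.finrank F (C ⊓ vanishingOutside F Y : Submodule F (Fin n → F))) ^ m =
      ∑ l ∈ Finset.range (m + 1),
        numSpanning F m l * ((subcodes C l).filter fun D => Supp D ⊆ Y).card := by
  set E : Submodule F (Fin n → F) := C ⊓ vanishingOutside F Y with hE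
  let T : Finset (Submodule F (Fin n → F)) := Finset.univ.filter fun D => D ≤ E
  let S : Finset (Fin m → Fin n → F) :=
    Finset.univ.filter fun v => Submodule.span F (Set.range v) ≤ E
  have hcard : S.card = (Fintype.card F ^ Module.finrank F E) ^ m := by
    have h1 : S = Fintype.piFinset fun _ : Fin m => Finset.univ.filter fun u => u ∈ E := by
      ext v
      simp [S, Submodule.span_le, Set.range_subset_iff]
    rw [h1, Fintype.card_piFinset, Finset.prod_const, Finset.card_univ, Fintype.card_fin,
      ← Fintype.card_subtype, ← Module.card_eq_pow_finrank (K := F) (V := E)]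
  rw [← hcard, Finset.card_eq_sum_card_fiberwise
    (f := fun v : Fin m → Fin n → F => Submodule.span F (Set.range v)) (t := T)
    (fun v hv => by simpa [S, T] using hv)]
  have h2 : ∀ D ∈ T, (S.filter fun v => Submodule.span F (Set.range v) = D).card =
      numSpanning F m (Module.finrank F D) := by
    intro D hD
    rw [← card_span_eq, Nat.card_eq_fintype_card, Fintype.card_subtype]
    congr 1
    ext v
    simp only [S, T, Finset.mem_filter, Finset.mem_univ, true_and] at hD ⊢
    exact ⟨fun h => h.2, fun h => ⟨h ▸ hD, h⟩⟩
  rw [Finset.sum_congr rfl h2]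
  have h3 : ∑ D ∈ T, numSpanning F m (Module.finrank F D) =
      ∑ D ∈ T.filter (fun D : Submodule F (Fin n → F) => Module.finrank F D ∈ Finset.range (m + 1)),
        numSpanning F m (Module.finrank F D) := by
    refine (Finset.sum_filter_of_ne fun _ _ hne => ?_).symm
    by_contra hlt
    exact hne (numSpanning_eq_zero (by simpa using hlt))
  rw [h3, ← Finset.sum_fiberwise_of_maps_to (t := Finset.range (m + 1))
    (g := fun D : Submodule F (Fin n → F) => Module.finrank F D)
    (fun D hD => (Finset.mem_filter.1 hD).2)]
  refine Finset.sum_congr rfl fun l hl => ?_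
  rw [Finset.sum_congr rfl (g := fun _ => numSpanning F m l)
    (fun D hD => by rw [(Finset.mem_filter.1 hD).2]), Finset.sum_const, smul_eq_mul, mul_comm]
  congr 2
  ext D
  simp only [T, hE, Finset.mem_filter, Finset.mem_univ, true_and, mem_subcodes, Supp_subset_iff,
    le_inf_iff]
  constructor
  · rintro ⟨⟨h, -⟩, rfl⟩
    exact ⟨⟨h.1, rfl⟩, h.2⟩
  · rintro ⟨⟨h, rfl⟩, h'⟩
    exact ⟨⟨⟨h, h'⟩, hl⟩, rfl⟩

end Tuples

/-! ### Independence of binomial polynomials -/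

section Binomial

/-- A function on a set of `N` natural numbers orthogonal to the binomial polynomials of degree
less than `N` vanishes: a Vandermonde argument in the binomial basis. -/
lemma eq_zero_of_sum_mul_choose_eq_zero (S : Finset ℕ) :
    ∀ c : ℕ → ℤ, (∀ p < S.card, ∑ x ∈ S, c x * (x.choose p : ℤ) = 0) → ∀ x ∈ S, c x = 0 := by
  induction S using Finset.induction_on with
  | empty => simp
  | insert a S ha ih =>
    intro c hc
    have hS : ∀ x ∈ S, c x = 0 := by
      intro x hx
      -- Multiplication by `x - a` kills the term at `a` and raises the degree by one.
      have h := ih (fun x => c x * ((x : ℤ) - a)) (fun p hp => ?_) x hx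
      · rcases mul_eq_zero.1 h with h | h
        · exact h
        · exact absurd (by omega : x = a) (fun hxa => ha (hxa ▸ hx))
      · have hcard := Finset.card_insert_of_notMem ha
        have h1 := hc p (by omega)
        have h2 := hc (p + 1) (by omega)
        have h3 : ∑ x ∈ insert a S, c x * ((x : ℤ) - a) * (x.choose p : ℤ) =
            (p + 1) * ∑ x ∈ insert a S, c x * (x.choose (p + 1) : ℤ) +
              ((p : ℤ) - a) * ∑ x ∈ insert a S, c x * (x.choose p : ℤ) := by
          rw [Finset.mul_sum, Finset.mul_sum, ← Finset.sum_add_distrib]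
          refine Finset.sum_congr rfl fun x _ => ?_
          have h4 : (x.choose (p + 1) : ℤ) * (p + 1) = x.choose p * ((x : ℤ) - p) := by
            rcases le_or_gt p x with hpx | hpx
            · have := Nat.choose_succ_right_eq x p
              rw [← Nat.cast_sub hpx]
              exact_mod_cast this
            · simp [Nat.choose_eq_zero_of_lt hpx, Nat.choose_eq_zero_of_lt (Nat.lt_succ_of_lt hpx)]
          linear_combination (-c x) * h4
        rw [h1, h2, mul_zero, mul_zero, add_zero, Finset.sum_insert ha] at h3
        simpa using h3
    intro x hx
    rcases Finset.mem_insert.1 hx with rfl | hx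
    · have h0 := hc 0 (by simp [Finset.card_insert_of_notMem ha])
      rw [Finset.sum_insert ha, Finset.sum_eq_zero fun y hy => by rw [hS y hy, zero_mul]] at h0
      simpa using h0
    · exact hS x hx

end Binomial

/-! ### Families of sets with uniform counts -/

section Combinatorics

variable {ι α : Type*} [DecidableEq α]

/-- The number of members of the indexed family `f` on `G` that have size `i`, contain `S` and are
disjoint from `T`. -/
def blockCount (G : Finset ι) (f : ι → Finset α) (S T : Finset α) (i : ℕ) : ℕ :=
  (G.filter fun D => S ⊆ f D ∧ Disjoint T (f D) ∧ (f D).card = i).card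

/-- Sorting by whether the point `a` belongs to the block. -/
lemma blockCount_insert_add (G : Finset ι) (f : ι → Finset α) (S T : Finset α) (a : α) (i : ℕ) :
    blockCount G f (insert a S) T i + blockCount G f S (insert a T) i = blockCount G f S T i := by
  unfold blockCount
  rw [← Finset.card_filter_add_card_filter_not (s := G.filter fun D => S ⊆ f D ∧ Disjoint T (f D) ∧
    (f D).card = i) (fun D => a ∈ f D), Finset.filter_filter, Finset.filter_filter]
  congr 2 <;>
  · refine Finset.filter_congr fun D _ => ?_
    simp only [Finset.insert_subset_iff, Finset.disjoint_insert_left]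
    tauto

/-- The counts of sets of size `i` containing `S` and avoiding `T`, for disjoint `S` and `T` with
at most `t` elements together, depend only on the sizes of `S` and `T`. -/
def IsUniform (G : Finset ι) (f : ι → Finset α) (t i : ℕ) : Prop :=
  ∃ φ : ℕ → ℕ → ℕ, ∀ S T : Finset α, Disjoint S T → S.card + T.card ≤ t →
    blockCount G f S T i = φ S.card T.card

/-- By `blockCount_insert_add`, a point can be moved from the avoided set to the contained set, so
the counts for `S = ∅` determine all others. The truncated subtraction in `φ` is exact at the values
that occur. -/
lemma isUniform_of_avoid (G : Finset ι) (f : ι → Finset α) (t i : ℕ) (ψ : ℕ → ℕ)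
    (h : ∀ T : Finset α, T.card ≤ t → blockCount G f ∅ T i = ψ T.card) : IsUniform G f t i := by
  let φ : ℕ → ℕ → ℕ := fun s => Nat.rec ψ (fun _ g b => g b - g (b + 1)) s
  refine ⟨φ, fun S => ?_⟩
  induction S using Finset.induction_on with
  | empty => intro T _ hT; exact h T (by simpa using hT)
  | insert a S ha ih =>
    intro T hST hcard
    rw [Finset.card_insert_of_notMem ha] at hcard ⊢
    rw [Finset.disjoint_insert_left] at hST
    have h1 := ih T hST.2 (by omega)
    have h2 := ih (insert a T) (by simp [Finset.disjoint_insert_right, ha, hST.2])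
      (by rw [Finset.card_insert_of_notMem hST.1]; omega)
    rw [Finset.card_insert_of_notMem hST.1] at h2
    have h3 := blockCount_insert_add G f S T a i
    have h4 : φ (S.card + 1) T.card = φ S.card T.card - φ S.card (T.card + 1) := rfl
    omega

/-- The counterpart of `isUniform_of_avoid` that starts from the counts for `T = ∅`. -/
lemma isUniform_of_contain (G : Finset ι) (f : ι → Finset α) (t i : ℕ) (ψ : ℕ → ℕ)
    (h : ∀ S : Finset α, S.card ≤ t → blockCount G f S ∅ i = ψ S.card) : IsUniform G f t i := by
  let φ : ℕ → ℕ → ℕ := fun s => Nat.rec ψ (fun _ g b => g b - g (b + 1)) s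
  refine ⟨fun a b => φ b a, fun S T => ?_⟩
  induction T using Finset.induction_on generalizing S with
  | empty => intro _ hS; exact h S (by simpa using hS)
  | insert a T ha ih =>
    intro hST hcard
    rw [Finset.card_insert_of_notMem ha] at hcard ⊢
    rw [Finset.disjoint_insert_right] at hST
    have h1 := ih S hST.2 (by omega)
    have h2 := ih (insert a S) (by simp [Finset.disjoint_insert_left, ha, hST.2])
      (by rw [Finset.card_insert_of_notMem hST.1]; omega)
    rw [Finset.card_insert_of_notMem hST.1] at h2
    have h3 := blockCount_insert_add G f S T a i
    have h4 : φ (T.card + 1) S.card = φ T.card S.card - φ T.card (S.card + 1) := rfl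
    simp only at h1 h2 ⊢
    omega

/-- Sorting the sets with `j` points outside `T` by their intersection with `T`. -/
lemma card_filter_sdiff_eq_sum (G : Finset ι) (f : ι → Finset α) (T : Finset α) (j : ℕ) :
    (G.filter fun D => (f D \ T).card = j).card =
      ∑ S ∈ T.powerset, blockCount G f S (T \ S) (j + S.card) := by
  rw [Finset.card_eq_sum_card_fiberwise (f := fun D => f D ∩ T) (t := T.powerset)
    (fun D _ => by simp)]
  refine Finset.sum_congr rfl fun S hS => ?_
  rw [Finset.mem_powerset] at hS
  unfold blockCount
  rw [Finset.filter_filter]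
  congr 1
  refine Finset.filter_congr fun D _ => ?_
  have hc := Finset.card_sdiff_add_card_inter (f D) T
  have hiff : f D ∩ T = S ↔ S ⊆ f D ∧ Disjoint (T \ S) (f D) := by
    rw [Finset.disjoint_left]
    constructor
    · rintro rfl
      exact ⟨Finset.inter_subset_left, by simp +contextual⟩
    · rintro ⟨h1, h2⟩
      ext x
      have := @h1 x
      have := @h2 x
      have := @hS x
      simp only [Finset.mem_inter, Finset.mem_sdiff] at *
      tauto
  rw [← and_assoc, ← hiff, and_comm]
  refine and_congr_right fun h => ?_
  rw [← h]
  omega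

/-- If, for `|T| ≤ t`, the distribution of the sizes of the sets with `T` removed depends only on
`|T|`, then the family is uniform. The induction is on the size `i`: a set of size `j + |T|` with
`j` points outside `T` contains `T`, and all the other sets with `j` points outside `T` are
smaller. -/
lemma isUniform_of_sdiff (G : Finset ι) (f : ι → Finset α) (t : ℕ) (β : ℕ → ℕ → ℕ)
    (h : ∀ T : Finset α, T.card ≤ t → ∀ j,
      (G.filter fun D => (f D \ T).card = j).card = β T.card j) (i : ℕ) :
    IsUniform G f t i := by
  induction i using Nat.strong_induction_on with
  | _ i ih =>
    choose! φ hφ using ih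
    refine isUniform_of_contain G f t i (fun s => if i < s then 0 else
      β s (i - s) - ∑ k ∈ Finset.range s, s.choose k • φ (i - s + k) k (s - k)) fun T hT => ?_
    split_ifs with hi
    · rw [blockCount, Finset.card_eq_zero, Finset.filter_eq_empty_iff]
      rintro D - ⟨h1, -, h2⟩
      have := Finset.card_le_card h1
      omega
    · have h1 := card_filter_sdiff_eq_sum G f T (i - T.card)
      rw [h T hT, ← Finset.sum_erase_add _ _ (Finset.mem_powerset_self T), Finset.sdiff_self,
        Nat.sub_add_cancel (not_lt.1 hi)] at h1
      have h2 : ∑ S ∈ T.powerset.erase T, blockCount G f S (T \ S) (i - T.card + S.card) =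
          ∑ k ∈ Finset.range T.card, T.card.choose k • φ (i - T.card + k) k (T.card - k) := by
        have h3 := Finset.sum_powerset_apply_card
          (fun k => if k < T.card then φ (i - T.card + k) k (T.card - k) else 0) (x := T)
        rw [← Finset.sum_erase_add _ _ (Finset.mem_powerset_self T), Finset.sum_range_succ] at h3
        simp only [lt_irrefl, if_false, add_zero, smul_zero] at h3
        rw [Finset.sum_congr (s₁ := Finset.range T.card) rfl
          fun k hk => by rw [if_pos (Finset.mem_range.1 hk)]] at h3
        rw [← h3]
        refine Finset.sum_congr rfl fun S hS => ?_
        obtain ⟨hne, hS⟩ := Finset.mem_erase.1 hS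
        rw [Finset.mem_powerset] at hS
        have hlt : S.card < T.card := Finset.card_lt_card (hS.ssubset_of_ne hne)
        rw [if_pos hlt, hφ (i - T.card + S.card) (by omega) S (T \ S) Finset.disjoint_sdiff
          (by rw [Finset.card_sdiff_of_subset hS]; omega), Finset.card_sdiff_of_subset hS]
      rw [h2] at h1
      omega

end Combinatorics

/-! ### MacWilliams identities for tuples of codewords -/

section MacWilliams

variable {F : Type*} [Field F] [Fintype F] {n : ℕ}

/-- The number of `l`-dimensional subcodes of `C` with support contained in `R` and missing exactly
`x` points of `R`. -/
noncomputable def insideCount (C : Submodule F (Fin n → F)) (l : ℕ) (R : Finset (Fin n))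
    (x : ℕ) : ℕ :=
  ((subcodes C l).filter fun D => Supp D ⊆ R ∧ (R \ Supp D).card = x).card

/-- The number of `l`-dimensional subcodes of `C` whose support misses exactly `x` points of `R`;
that is, the weight distribution of `C` punctured to `R`, up to complementing the weight. -/
noncomputable def puncturedCount (C : Submodule F (Fin n → F)) (l : ℕ) (R : Finset (Fin n))
    (x : ℕ) : ℕ :=
  ((subcodes C l).filter fun D => (R \ Supp D).card = x).card

/-- Double counting of the pairs consisting of a member of the family and a `p`-subset of `R`
disjoint from it. -/
lemma sum_card_filter_powersetCard {ι : Type*} (G : Finset ι) (f : ι → Finset (Fin n))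
    (R : Finset (Fin n)) (p : ℕ) :
    ∑ Z ∈ R.powersetCard p, (G.filter fun D => Disjoint Z (f D)).card =
      ∑ x ∈ Finset.range (R.card + 1),
        (G.filter fun D => (R \ f D).card = x).card * x.choose p := by
  have h1 := Finset.sum_card_bipartiteAbove_eq_sum_card_bipartiteBelow
    (fun (Z : Finset (Fin n)) (D : ι) => Disjoint Z (f D)) (s := R.powersetCard p) (t := G)
  unfold Finset.bipartiteAbove Finset.bipartiteBelow at h1
  rw [h1, ← Finset.sum_fiberwise_of_maps_to (t := Finset.range (R.card + 1))
    (g := fun D => (R \ f D).card)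
    (fun D _ => Finset.mem_range.2 (Nat.lt_succ_of_le (Finset.card_le_card Finset.sdiff_subset)))]
  refine Finset.sum_congr rfl fun x _ => ?_
  rw [← smul_eq_mul, ← Finset.sum_const]
  refine Finset.sum_congr rfl fun D hD => ?_
  rw [← (Finset.mem_filter.1 hD).2, ← Finset.card_powersetCard]
  congr 1
  ext Z
  simp only [Finset.mem_filter, Finset.mem_powersetCard, Finset.subset_sdiff]
  tauto

lemma sum_powersetCard_sdiff {M : Type*} [AddCommMonoid M] (R : Finset (Fin n)) (p : ℕ)
    (hp : p ≤ R.card) (g : Finset (Fin n) → M) :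
    ∑ Z ∈ R.powersetCard p, g (R \ Z) = ∑ Y ∈ R.powersetCard (R.card - p), g Y := by
  refine Finset.sum_nbij' (fun Z => R \ Z) (fun Y => R \ Y) ?_ ?_ ?_ ?_ ?_
  · intro Z hZ
    rw [Finset.mem_powersetCard] at hZ ⊢
    exact ⟨Finset.sdiff_subset, by rw [Finset.card_sdiff_of_subset hZ.1, hZ.2]⟩
  · intro Z hZ
    rw [Finset.mem_powersetCard] at hZ ⊢
    exact ⟨Finset.sdiff_subset, by rw [Finset.card_sdiff_of_subset hZ.1, hZ.2]; omega⟩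
  · intro Z hZ
    exact Finset.sdiff_sdiff_eq_self (Finset.mem_powersetCard.1 hZ).1
  · intro Z hZ
    exact Finset.sdiff_sdiff_eq_self (Finset.mem_powersetCard.1 hZ).1
  · intro Z _
    rfl

/-- The MacWilliams identities in binomial form, for the `m`-tuples of words, between `C` punctured
to `R` and the dual code shortened to `R`. -/
lemma macWilliams (C : Submodule F (Fin n → F)) (m : ℕ) (R : Finset (Fin n)) (p : ℕ)
    (hp : p ≤ R.card) :
    (Fintype.card F ^ Module.finrank F C) ^ m *
        ∑ l ∈ Finset.range (m + 1), numSpanning F m l *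
          ∑ x ∈ Finset.range (R.card + 1), insideCount (dualCode C) l R x * x.choose p =
      (Fintype.card F ^ (R.card - p)) ^ m *
        ∑ l ∈ Finset.range (m + 1), numSpanning F m l *
          ∑ x ∈ Finset.range (R.card + 1),
            puncturedCount C l R x * x.choose (R.card - p) := by
  classical
  have hin : ∀ l, ∑ x ∈ Finset.range (R.card + 1), insideCount (dualCode C) l R x * x.choose p =
      ∑ Y ∈ R.powersetCard (R.card - p),
        ((subcodes (dualCode C) l).filter fun D => Supp D ⊆ Y).card := by
    intro l
    have h1 := sum_card_filter_powersetCard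
      ((subcodes (dualCode C) l).filter fun D => Supp D ⊆ R) Supp R p
    simp only [Finset.filter_filter] at h1
    unfold insideCount
    rw [← h1, ← sum_powersetCard_sdiff R p hp]
    refine Finset.sum_congr rfl fun Z _ => ?_
    congr 1
    refine Finset.filter_congr fun D _ => ?_
    rw [Finset.subset_sdiff, disjoint_comm]
  have hout : ∀ l, ∑ x ∈ Finset.range (R.card + 1),
        puncturedCount C l R x * x.choose (R.card - p) =
      ∑ Y ∈ R.powersetCard (R.card - p),
        ((subcodes C l).filter fun D => Supp D ⊆ Yᶜ).card := by
    intro l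
    unfold puncturedCount
    rw [← sum_card_filter_powersetCard]
    refine Finset.sum_congr rfl fun Z _ => ?_
    congr 1
    refine Finset.filter_congr fun D _ => ?_
    rw [Finset.subset_compl_iff_disjoint_left]
  simp only [hin, hout, Finset.mul_sum (s := Finset.powersetCard _ _)]
  rw [Finset.sum_comm, Finset.sum_comm (s := Finset.range (m + 1)), Finset.mul_sum, Finset.mul_sum]
  refine Finset.sum_congr rfl fun Y hY => ?_
  rw [← pow_finrank_inf_eq_sum, ← pow_finrank_inf_eq_sum, ← mul_pow, ← mul_pow, ← pow_add,
    ← pow_add, add_comm, finrank_dualCode_inf_add, (Finset.mem_powersetCard.1 hY).2]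

end MacWilliams

/-! ### Counts determined by few dual weights, and designs -/

section AssmusMattson

variable {F : Type*} [Field F] [Fintype F] {n : ℕ}

lemma genHammingWeight_le_wt {C D : Submodule F (Fin n → F)} {l : ℕ} (hD : D ∈ subcodes C l) :
    genHammingWeight C l ≤ wt D :=
  iInf₂_le (f := fun D _ => (wt D : ℕ∞)) D (mem_subcodes.1 hD)

/-- Lowering `t` to `s` adds at most `t - s` weights, so the hypothesis on the number of dual weights
for `t` implies the one for every `s ≤ t`. -/
lemma card_dualWeights_le (C : Submodule F (Fin n → F)) (m : ℕ) {s t : ℕ} (hst : s ≤ t) :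
    (dualWeights C m s).card + s ≤ (dualWeights C m t).card + t := by
  classical
  have hsub : dualWeights C m s ⊆ dualWeights C m t ∪ Finset.Ico (n + 1 - t) (n + 1 - s) := by
    intro i
    simp only [dualWeights, Finset.mem_union, Finset.mem_filter, Finset.mem_Ico]
    rintro ⟨h1, h2, h3, h4⟩
    by_cases hi : i + t ≤ n
    · exact Or.inl ⟨h1, h2, hi, h4⟩
    · exact Or.inr ⟨by omega, by omega⟩
  have h1 := (Finset.card_le_card hsub).trans (Finset.card_union_le _ _)
  rw [Nat.card_Ico] at h1
  omega

lemma qProd_pos {q : ℕ} (hq : 1 < q) {m l : ℕ} (hl : l ≤ m) : 0 < qProd q m l := by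
  refine Finset.prod_pos fun i hi => sub_pos.2 ?_
  exact_mod_cast Nat.pow_lt_pow_right hq (by have := Finset.mem_range.1 hi; omega)

/-- All terms of the sum in the definition of `dualWeights` are nonnegative, so a single subcode of
dimension `m` makes it positive. -/
lemma wt_mem_dualWeights {C D : Submodule F (Fin n → F)} {m s : ℕ}
    (hD : D ∈ subcodes (dualCode C) m) (hs : wt D + s ≤ n) : wt D ∈ dualWeights C m s := by
  classical
  have hq : 1 < Fintype.card F := Fintype.one_lt_card
  simp only [dualWeights, Finset.mem_filter, Finset.mem_range]
  refine ⟨by omega, genHammingWeight_le_wt hD, hs, (Finset.sum_pos' (fun l hl => ?_)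
    ⟨m, Finset.self_mem_range_succ m, ?_⟩).ne'⟩
  · exact mul_nonneg (qProd_pos hq (by have := Finset.mem_range.1 hl; omega)).le (by positivity)
  · refine mul_pos (qProd_pos hq le_rfl) ?_
    have h : 0 < higherWeight (dualCode C) m (wt D) :=
      Finset.card_pos.2 ⟨D, Finset.mem_filter.2 ⟨hD, rfl⟩⟩
    exact_mod_cast h

lemma Supp_eq_empty_of_mem_subcodes_zero {C D : Submodule F (Fin n → F)}
    (hD : D ∈ subcodes C 0) : Supp D = ∅ := by
  have h : D = ⊥ := Submodule.finrank_eq_zero.1 (mem_subcodes.1 hD).2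
  ext i
  simp [mem_Supp, h]

/-- If the dual weights in dimension `m` are few compared with `d_m(C)`, then the counts for
dimension `m` are determined by the counts for smaller dimensions: of the MacWilliams identities,
those of low degree involve only the shortened dual code, and there are enough of them to determine
its unknown counts. -/
lemma count_eq_of_count_lt_eq (C : Submodule F (Fin n → F)) {m s : ℕ}
    {R R' : Finset (Fin n)} (hR : R.card + s = n) (hR' : R'.card + s = n)
    (hL : (((dualWeights C m s).card + s : ℕ) : ℕ∞) ≤ genHammingWeight C m)
    (ih : ∀ l < m, ∀ x, insideCount (dualCode C) l R x = insideCount (dualCode C) l R' x ∧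
      puncturedCount C l R x = puncturedCount C l R' x) (x : ℕ) :
    insideCount (dualCode C) m R x = insideCount (dualCode C) m R' x ∧
      puncturedCount C m R x = puncturedCount C m R' x := by
  classical
  obtain ⟨N, hN⟩ : ∃ N, R.card = N := ⟨_, rfl⟩
  have hN' : R'.card = N := by omega
  -- The differences of the counts for `R` and `R'`; both are to be shown to vanish.
  let w : ℕ → ℤ := fun x => insideCount (dualCode C) m R x - insideCount (dualCode C) m R' x
  let b : ℕ → ℤ := fun x => puncturedCount C m R x - puncturedCount C m R' x
  have hsp : (numSpanning F m m : ℤ) ≠ 0 := by exact_mod_cast (numSpanning_self_pos (F := F) m).ne'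
  have hq : (Fintype.card F : ℤ) ≠ 0 := by exact_mod_cast Fintype.card_ne_zero
  have hmac : ∀ p ≤ N, ((Fintype.card F : ℤ) ^ Module.finrank F C) ^ m *
        ∑ x ∈ Finset.range (N + 1), w x * (x.choose p : ℤ) =
      ((Fintype.card F : ℤ) ^ (N - p)) ^ m *
        ∑ x ∈ Finset.range (N + 1), b x * (x.choose (N - p) : ℤ) := by
    intro p hp
    have h1 := macWilliams C m R p (by omega)
    have h2 := macWilliams C m R' p (by omega)
    rw [hN] at h1
    rw [hN'] at h2
    rw [Finset.sum_range_succ, Finset.sum_range_succ (n := m)] at h1 h2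
    have e1 : ∑ l ∈ Finset.range m, numSpanning F m l * ∑ x ∈ Finset.range (N + 1),
          insideCount (dualCode C) l R x * x.choose p =
        ∑ l ∈ Finset.range m, numSpanning F m l * ∑ x ∈ Finset.range (N + 1),
          insideCount (dualCode C) l R' x * x.choose p :=
      Finset.sum_congr rfl fun l hl => by simp only [(ih l (Finset.mem_range.1 hl) _).1]
    have e2 : ∑ l ∈ Finset.range m, numSpanning F m l * ∑ x ∈ Finset.range (N + 1),
          puncturedCount C l R x * x.choose (N - p) =
        ∑ l ∈ Finset.range m, numSpanning F m l * ∑ x ∈ Finset.range (N + 1),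
          puncturedCount C l R' x * x.choose (N - p) :=
      Finset.sum_congr rfl fun l hl => by simp only [(ih l (Finset.mem_range.1 hl) _).2]
    rw [e1, e2] at h1
    zify at h1 h2
    simp only [w, b, sub_mul, Finset.sum_sub_distrib]
    apply mul_left_cancel₀ hsp
    linear_combination h1 - h2
  -- The positions `x` where an unknown of the shortened dual code may be nonzero.
  let S : Finset ℕ := (Finset.range (N + 1)).filter fun x => N - x ∈ dualWeights C m s
  have hS : S.card ≤ (dualWeights C m s).card := by
    refine Finset.card_le_card_of_injOn (fun x => N - x) (fun x hx => (Finset.mem_filter.1 hx).2) ?_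
    intro x hx y hy hxy
    have h1 := Finset.mem_range.1 (Finset.mem_filter.1 hx).1
    have h2 := Finset.mem_range.1 (Finset.mem_filter.1 hy).1
    simp only at hxy
    omega
  have hwS : ∀ Q : Finset (Fin n), Q.card = N → ∀ x ∉ S, insideCount (dualCode C) m Q x = 0 := by
    intro Q hQ x hx
    rw [insideCount, Finset.card_eq_zero, Finset.filter_eq_empty_iff]
    rintro D hD ⟨h1, h2⟩
    rw [Finset.card_sdiff_of_subset h1, hQ] at h2
    have h3 := Finset.card_le_card h1
    have h4 := wt_mem_dualWeights hD (s := s) (by unfold wt; omega)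
    refine hx (Finset.mem_filter.2 ⟨Finset.mem_range.2 (by omega), ?_⟩)
    rwa [show N - x = wt D by unfold wt; omega]
  have hbS : ∀ Q : Finset (Fin n), Q.card = N → ∀ x, N < x + (dualWeights C m s).card →
      puncturedCount C m Q x = 0 := by
    intro Q hQ x hx
    rw [puncturedCount, Finset.card_eq_zero, Finset.filter_eq_empty_iff]
    rintro D hD h2
    have h3 : (dualWeights C m s).card + s ≤ wt D := by
      exact_mod_cast hL.trans (genHammingWeight_le_wt hD)
    have h4 := Finset.card_union_of_disjoint (Finset.sdiff_disjoint (s := Supp D) (t := Q))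
    have h5 := Finset.card_le_univ (Q \ Supp D ∪ Supp D)
    rw [Fintype.card_fin] at h5
    unfold wt at h3
    omega
  have hbig : ∀ Q : Finset (Fin n), Q.card = N → ∀ x, N < x →
      insideCount (dualCode C) m Q x = 0 ∧ puncturedCount C m Q x = 0 := by
    intro Q hQ x hx
    exact ⟨hwS Q hQ x fun h => by have := Finset.mem_range.1 (Finset.mem_filter.1 h).1; omega,
      hbS Q hQ x (by omega)⟩
  have hw0 : ∀ x, w x = 0 := by
    have h1 : ∀ x ∈ S, w x = 0 := by
      refine eq_zero_of_sum_mul_choose_eq_zero S w fun p hp => ?_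
      have hpN : p ≤ N := by
        have := Finset.card_filter_le (Finset.range (N + 1)) fun x => N - x ∈ dualWeights C m s
        rw [Finset.card_range] at this
        change S.card ≤ N + 1 at this
        omega
      have h2 := hmac p hpN
      -- Where `b` may be nonzero, `x < N - p`, so the binomial coefficient vanishes.
      have h3 : ∑ x ∈ Finset.range (N + 1), b x * (x.choose (N - p) : ℤ) = 0 := by
        refine Finset.sum_eq_zero fun x _ => ?_
        by_cases hx : N < x + (dualWeights C m s).card
        · simp [b, hbS R hN x hx, hbS R' hN' x hx]
        · rw [Nat.choose_eq_zero_of_lt (by omega), Nat.cast_zero, mul_zero]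
      rw [h3, mul_zero] at h2
      have h4 := (mul_eq_zero.1 h2).resolve_left (pow_ne_zero _ (pow_ne_zero _ hq))
      rw [← h4]
      refine Finset.sum_subset (Finset.filter_subset _ _) fun x _ hx => ?_
      simp [w, hwS R hN x hx, hwS R' hN' x hx]
    intro x
    by_cases hx : x ∈ S
    · exact h1 x hx
    · simp [w, hwS R hN x hx, hwS R' hN' x hx]
  have hb0 : ∀ x, b x = 0 := by
    intro x
    rcases lt_or_ge N x with hx | hx
    · simp [b, (hbig R hN x hx).2, (hbig R' hN' x hx).2]
    refine eq_zero_of_sum_mul_choose_eq_zero (Finset.range (N + 1)) b (fun p hp => ?_) x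
      (Finset.mem_range.2 (by omega))
    rw [Finset.card_range] at hp
    have h2 := hmac (N - p) (by omega)
    rw [Nat.sub_sub_self (by omega)] at h2
    simp only [hw0, zero_mul, Finset.sum_const_zero, mul_zero] at h2
    exact (mul_eq_zero.1 h2.symm).resolve_left (pow_ne_zero _ (pow_ne_zero _ hq))
  exact ⟨by exact_mod_cast sub_eq_zero.1 (hw0 x), by exact_mod_cast sub_eq_zero.1 (hb0 x)⟩

/-- The higher weight distributions of the punctured code and of the shortened dual code depend
only on the number `s ≤ t` of coordinates removed. -/
lemma count_eq_of_card_eq (C : Submodule F (Fin n → F)) {r s t : ℕ} (hst : s ≤ t)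
    (hL : ∀ m : ℕ, 1 ≤ m → m ≤ r →
      (((dualWeights C m t).card + t : ℕ) : ℕ∞) ≤ genHammingWeight C m)
    {R R' : Finset (Fin n)} (hR : R.card + s = n) (hR' : R'.card + s = n)
    {m : ℕ} (hm : m ≤ r) (x : ℕ) :
    insideCount (dualCode C) m R x = insideCount (dualCode C) m R' x ∧
      puncturedCount C m R x = puncturedCount C m R' x := by
  induction m using Nat.strong_induction_on generalizing x with
  | _ m ih =>
    rcases Nat.eq_zero_or_pos m with rfl | hpos
    · have hcard : R.card = R'.card := by omega
      refine ⟨congrArg Finset.card ?_, congrArg Finset.card ?_⟩ <;>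
      · refine Finset.filter_congr fun D hD => ?_
        rw [Supp_eq_empty_of_mem_subcodes_zero hD]
        simp [hcard]
    · refine count_eq_of_count_lt_eq C hR hR' ?_ (fun l hl y => ih l hl (by omega) y) x
      exact le_trans (by exact_mod_cast card_dualWeights_le C m hst) (hL m hpos hm)

lemma exists_eq_card {β : Type*} [Inhabited β] (t : ℕ) (g : Finset (Fin n) → β)
    (h : ∀ T T' : Finset (Fin n), T.card ≤ t → T.card = T'.card → g T = g T') :
    ∃ ψ : ℕ → β, ∀ T, T.card ≤ t → g T = ψ T.card := by
  classical
  refine ⟨fun s => if hs : ∃ T : Finset (Fin n), T.card = s then g hs.choose else default,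
    fun T hT => ?_⟩
  have hs : ∃ T' : Finset (Fin n), T'.card = T.card := ⟨T, rfl⟩
  simp only [dif_pos hs]
  exact h _ _ hT hs.choose_spec.symm

lemma isTDesign_of_isUniform {C : Submodule F (Fin n → F)} {r t i : ℕ}
    (h : IsUniform (subcodes C r) Supp t i) : IsTDesign t (supportsOfSize C r i) := by
  obtain ⟨φ, hφ⟩ := h
  refine ⟨i, φ t 0, fun X hX => (Multiset.mem_filter.1 hX).2, fun T hT => ?_⟩
  have h1 := hφ T ∅ (Finset.disjoint_empty_right T) (by simp [hT])
  rw [hT, Finset.card_empty] at h1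
  rw [← h1, supportsOfSize, supports, Multiset.filter_filter, Multiset.filter_map,
    Multiset.card_map, blockCount, Finset.card_def, Finset.filter_val]
  congr 1
  refine Multiset.filter_congr fun D _ => ?_
  simp

lemma card_compl_add_card (T : Finset (Fin n)) : Tᶜ.card + T.card = n := by
  rw [Finset.card_compl_add_card, Fintype.card_fin]

lemma count_eq_of_card_compl_eq (C : Submodule F (Fin n → F)) {r t : ℕ}
    (hL : ∀ m : ℕ, 1 ≤ m → m ≤ r →
      (((dualWeights C m t).card + t : ℕ) : ℕ∞) ≤ genHammingWeight C m)
    {T T' : Finset (Fin n)} (hT : T.card ≤ t) (hTT' : T.card = T'.card) (x : ℕ) :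
    insideCount (dualCode C) r Tᶜ x = insideCount (dualCode C) r T'ᶜ x ∧
      puncturedCount C r Tᶜ x = puncturedCount C r T'ᶜ x :=
  count_eq_of_card_eq C hT hL (card_compl_add_card T) (hTT' ▸ card_compl_add_card T') le_rfl x

/-- A subcode `D` with `|Supp D ∖ T| = j` misses `n - |T| - j` points of the complement of `T`, so
`puncturedCount` is the distribution that `isUniform_of_sdiff` asks for. -/
lemma isUniform_subcodes (C : Submodule F (Fin n → F)) {r t : ℕ}
    (hL : ∀ m : ℕ, 1 ≤ m → m ≤ r →
      (((dualWeights C m t).card + t : ℕ) : ℕ∞) ≤ genHammingWeight C m) (i : ℕ) :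
    IsUniform (subcodes C r) Supp t i := by
  obtain ⟨β, hβ⟩ := exists_eq_card t (fun (T : Finset (Fin n)) (j : ℕ) =>
      ((subcodes C r).filter fun D => (Supp D \ T).card = j).card) fun T T' hT hTT' => by
    funext j
    have key : ∀ Q : Finset (Fin n), Q.card = T.card →
        ((subcodes C r).filter fun D => (Supp D \ Q).card = j).card =
        if j + T.card ≤ n then puncturedCount C r Qᶜ (n - T.card - j) else 0 := by
      intro Q hQ
      have h1 : ∀ D : Submodule F (Fin n → F),
          (Qᶜ \ Supp D).card + (Supp D \ Q).card + T.card = n := by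
        intro D
        have h2 := card_compl_add_card Q
        have h3 := Finset.card_sdiff_add_card_inter Qᶜ (Supp D)
        rw [Finset.inter_comm, ← Finset.sdiff_eq_inter_compl] at h3
        omega
      split_ifs with hj
      · unfold puncturedCount
        congr 1
        refine Finset.filter_congr fun D _ => ?_
        have := h1 D
        omega
      · rw [Finset.card_eq_zero, Finset.filter_eq_empty_iff]
        intro D _ h2
        have := h1 D
        omega
    rw [key T rfl, key T' hTT'.symm, (count_eq_of_card_compl_eq C hL hT hTT' _).2]
  exact isUniform_of_sdiff _ _ t β (fun T hT j => congrFun (hβ T hT) j) i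

/-- A subcode of weight `j` disjoint from `T` lies in the complement of `T` and misses `n - |T| - j`
of its points, so `insideCount` gives the counts that `isUniform_of_avoid` asks for. -/
lemma isUniform_subcodes_dualCode (C : Submodule F (Fin n → F)) {r t : ℕ}
    (hL : ∀ m : ℕ, 1 ≤ m → m ≤ r →
      (((dualWeights C m t).card + t : ℕ) : ℕ∞) ≤ genHammingWeight C m) (j : ℕ) :
    IsUniform (subcodes (dualCode C) r) Supp t j := by
  obtain ⟨ψ, hψ⟩ := exists_eq_card t (fun T : Finset (Fin n) =>
      blockCount (subcodes (dualCode C) r) Supp ∅ T j) fun T T' hT hTT' => by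
    have key : ∀ Q : Finset (Fin n), Q.card = T.card →
        blockCount (subcodes (dualCode C) r) Supp ∅ Q j =
        if j + T.card ≤ n then insideCount (dualCode C) r Qᶜ (n - T.card - j) else 0 := by
      intro Q hQ
      have h2 := card_compl_add_card Q
      split_ifs with hj
      · unfold insideCount blockCount
        congr 1
        refine Finset.filter_congr fun D _ => ?_
        rw [Finset.subset_compl_iff_disjoint_left]
        simp only [Finset.empty_subset, true_and]
        refine and_congr_right fun h => ?_
        have h3 : Supp D ⊆ Qᶜ := Finset.subset_compl_iff_disjoint_left.2 h
        have h4 := Finset.card_le_card h3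
        rw [Finset.card_sdiff_of_subset h3]
        omega
      · rw [blockCount, Finset.card_eq_zero, Finset.filter_eq_empty_iff]
        rintro D _ ⟨-, h, h5⟩
        have h4 := Finset.card_le_card (Finset.subset_compl_iff_disjoint_left.2 h)
        omega
    rw [key T rfl, key T' hTT'.symm, (count_eq_of_card_compl_eq C hL hT hTT' _).1]
  exact isUniform_of_avoid _ _ t j ψ hψ

end AssmusMattson

end SubcodeDesign

theorem mainTheorem9 {F : Type*} [Field F] [Fintype F] (n k d r t : ℕ)
    (C : Submodule F (Fin n → F))
    (hk : Module.finrank F C = k)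
    (hd : SubcodeDesign.minWeight C = (d : ℕ∞))
    (hr1 : 1 ≤ r) (ht1 : 1 ≤ t) (hrk : r ≤ k) (htd : t ≤ d)
    (hL : ∀ m : ℕ, 1 ≤ m → m ≤ r →
      (((SubcodeDesign.dualWeights C m t).card + t : ℕ) : ℕ∞)
        ≤ SubcodeDesign.genHammingWeight C m) :
    (∀ i : ℕ, SubcodeDesign.genHammingWeight C r ≤ (i : ℕ∞) →
      SubcodeDesign.IsTDesign t (SubcodeDesign.supportsOfSize C r i)) ∧
    (∀ j : ℕ, SubcodeDesign.genHammingWeight (SubcodeDesign.dualCode C) r ≤ (j : ℕ∞) →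
      j + t ≤ n →
      SubcodeDesign.IsTDesign t
        (SubcodeDesign.supportsOfSize (SubcodeDesign.dualCode C) r j)) := by
  exact ⟨fun i _ => SubcodeDesign.isTDesign_of_isUniform (SubcodeDesign.isUniform_subcodes C hL i),
    fun j _ _ => SubcodeDesign.isTDesign_of_isUniform
      (SubcodeDesign.isUniform_subcodes_dualCode C hL j)⟩
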